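/- For positive integers $a_1,a_2,\ldots$ let $$[a_1,a_2,a_3,\ldots]=\cfrac{1}{a_1+\cfrac{1}{a_2+\cfrac{1}{a_3+\cdots}}}$$ denote the value of the infinite continued fraction, i.e. the limit of its convergents. For every integer $A\ge 1$ put $$\mathfrak{C}_A=\big\{[b_1,1,b_2,1,b_3,1,\ldots]\;:\; b_i\in\mathbb{Z},\ 1\le b_i\le A\ \text{ for all } i\ge 1\big\}\subset\mathbb{R},\qquad \mathfrak{C}_\infty=\bigcup_{A=1}^{\infty}\mathfrak{C}_A,$$ and let $\vartheta_A$ and $\vartheta_\infty$ be the Hausdorff dimensions of $\mathfrak{C}_A$ and $\mathfrak{C}_\infty$. Then $\vartheta_\infty>0.775$. In fact, already for $A=110$ we have $\vartheta_{110}>0.775$. -/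

import Mathlib

/-- The infinite regular continued fraction `[a 0, a 1, a 2, …]` with integer part `0`, that is
`1 / (a 0 + 1 / (a 1 + 1 / (a 2 + ⋯)))`, as a (formal) continued fraction over `ℝ`: all partial
numerators are `1` and the partial denominators are the `a n`. -/
noncomputable def regularCF (a : ℕ → ℕ) : GenContFract ℝ :=
  ⟨0, Stream'.Seq.ofStream fun n => ⟨1, (a n : ℝ)⟩⟩

/-- `x` is the value of the infinite continued fraction `[a 0, a 1, a 2, …]`: the sequence of its
convergents `0, [a 0], [a 0, a 1], …` tends to `x`. -/
def HasCFValue (a : ℕ → ℕ) (x : ℝ) : Prop :=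
  Filter.Tendsto (regularCF a).convs Filter.atTop (nhds x)

/-- The sequence `b 0, 1, b 1, 1, b 2, 1, …`. -/
def withOnes (b : ℕ → ℕ) (n : ℕ) : ℕ :=
  if Even n then b (n / 2) else 1

/-- The set `C_A` of all `[b₁, 1, b₂, 1, …]` with `1 ≤ bᵢ ≤ A` for every `i`. -/
def fractalC (A : ℕ) : Set ℝ :=
  {x | ∃ b : ℕ → ℕ, (∀ i, 1 ≤ b i ∧ b i ≤ A) ∧ HasCFValue (withOnes b) x}

/-- The union `C_∞` of the sets `C_A` over all integers `A ≥ 1`. -/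
def fractalCInfty : Set ℝ :=
  ⋃ A ∈ Set.Ici (1 : ℕ), fractalC A

/-! Pairing each digit `b` with the following 1 turns the fraction into an iterated function system
of Möbius maps `x ↦ (1 + x) / (b x + b + 1)` of determinant 1, whose derivative is the inverse
square of the denominator. The dimension exceeds 31/40 as soon as the transfer operator `L f x = ∑ b
≤ 110, den b x ^ (-31/20) * f (branch b x)` (31/20 = 2 · 0.775) expands some positive function: `L f
≥ (20001/20000) f`.

Such an `f` is `testFun`. Its summands `(d (x+1) + e) ^ (-31/20)` are carried by each branch to
powers of the same kind, so both sides of the inequality are sums of convex functions. On each of 40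
cells covering [0, 5/8], tangents bound `L f` from below and chords bound `f` from above; only
endpoint inequalities remain, and integer arithmetic verifies them (`cellCheck_true`,
`testFun_le_transfer`).

Iterating `L` until the growth beats the bounds on `f` gives a length `n` for which the words `w`
satisfy `∑ w, r w ^ 0.775 > 1`, where `r w` is the inverse square of the denominator of `w` at 5/8
(`exists_one_lt_sum_denIter`). Words of length `n` then serve as letters: their codes are separated
at the scale of products of `r w` (`le_abs_branchLimit_concatWords_sub`), and a Bernoulli measure
gives the bound (`le_dimH_range_of_separated`). Continuity in the exponent makes it strict. -/

open MeasureTheory in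
/-- **Mass distribution principle for coded sets.** If points whose codes agree exactly up to place
`k` are at a distance of at least `δ * r (ω 0) * ⋯ * r (ω (k - 1))` and `∑ i, r i ^ s ≥ 1`, then the
coded set has Hausdorff dimension at least `s`. -/
theorem le_dimH_range_of_separated {ι : Type*} [Fintype ι] [Nonempty ι] [MeasurableSpace ι]
    [MeasurableSingletonClass ι] {π : (ℕ → ι) → ℝ} (hπ : Measurable π) {r : ι → ℝ}
    (hr0 : ∀ i, 0 < r i) (hr1 : ∀ i, r i < 1) {δ : ℝ} (hδ : 0 < δ)
    (hsep : ∀ ω ω' : ℕ → ι, ∀ k, (∀ i < k, ω i = ω' i) → ω k ≠ ω' k →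
      δ * ∏ i ∈ Finset.range k, r (ω i) ≤ |π ω - π ω'|)
    {s : NNReal} (hs : 0 < s) (hsum : 1 ≤ ∑ i, r i ^ (s : ℝ)) :
    (s : ENNReal) ≤ dimH (Set.range π) := by
  classical
  set Z : ℝ := ∑ i, r i ^ (s : ℝ) with hZ
  have hZ0 : 0 < Z := by linarith
  have hs' : (0 : ℝ) < s := hs
  have hrs : ∀ i, 0 < r i ^ (s : ℝ) := fun i => Real.rpow_pos_of_pos (hr0 i) _
  -- Bernoulli weights proportional to `r i ^ s`. As `Z ≥ 1`, normalising only lowers the masses of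
  -- cylinders.
  let pmf : PMF ι := PMF.ofFintype (fun i => ENNReal.ofReal (r i ^ (s : ℝ) / Z)) (by
    rw [← ENNReal.ofReal_sum_of_nonneg fun i _ => (div_pos (hrs i) hZ0).le, ← Finset.sum_div,
      div_self hZ0.ne', ENNReal.ofReal_one])
  let P : Measure (ℕ → ι) := Measure.infinitePi fun _ => pmf.toMeasure
  have hcyl : ∀ (v : ℕ → ι) (n : ℕ), P {ω | ∀ k < n, ω k = v k} ≤
      ENNReal.ofReal (∏ k ∈ Finset.range n, r (v k) ^ (s : ℝ)) := by
    intro v n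
    have h1 : {ω : ℕ → ι | ∀ k < n, ω k = v k} =
        Set.pi (Finset.range n : Set ℕ) fun k => {v k} := by
      ext ω; simp [Set.mem_pi]
    rw [h1, Measure.infinitePi_pi _ fun i _ => measurableSet_singleton _,
      ENNReal.ofReal_prod_of_nonneg fun i _ => (hrs _).le]
    refine Finset.prod_le_prod' fun k _ => ?_
    rw [PMF.toMeasure_apply_singleton _ _ (measurableSet_singleton _), PMF.ofFintype_apply]
    exact ENNReal.ofReal_le_ofReal (div_le_self (hrs _).le hsum)
  obtain ⟨q, hq0, hq1, hq⟩ : ∃ q : ℝ, 0 ≤ q ∧ q < 1 ∧ ∀ i, r i ^ (s : ℝ) ≤ q := by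
    obtain ⟨j, hj⟩ := Finite.exists_max fun i => r i ^ (s : ℝ)
    exact ⟨_, (hrs j).le, Real.rpow_lt_one (hr0 j).le (hr1 j) hs', hj⟩
  have hδs : 0 < δ ^ (s : ℝ) := Real.rpow_pos_of_pos hδ _
  set C : ENNReal := ENNReal.ofReal (δ ^ (s : ℝ)) with hC
  have hC0 : C ≠ 0 := by simpa [hC] using hδs
  let μ : Measure ℝ := P.map π
  have hmass : ∀ U : Set ℝ, C * μ U ≤ Metric.ediam U ^ (s : ℝ) := by
    intro U
    -- The closure has the same diameter and is measurable, so its mass can be computed on codes.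
    rw [← Metric.ediam_closure U]
    have hV := (isClosed_closure (s := U)).measurableSet
    refine (mul_le_mul_right (measure_mono subset_closure) _).trans ?_
    rw [Measure.map_apply hπ hV]
    set V := closure U
    rcases (π ⁻¹' V).eq_empty_or_nonempty with he | ⟨ω₀, hω₀⟩
    · simp [he]
    -- At the first place `k` where a code over `V` departs from `ω₀`, the cylinder of length `k`
    -- bounds the mass and separation bounds the diameter. Without such a place, `ω₀` is the only
    -- code, and its mass is 0.
    by_cases hA : ∃ k, ∃ ω ∈ π ⁻¹' V, ω₀ k ≠ ω k
    · have hmin := fun m hm => Nat.find_min hA (m := m) hm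
      obtain ⟨ω, hω, hne⟩ := Nat.find_spec hA
      set k := Nat.find hA
      have hagree : ∀ ω' ∈ π ⁻¹' V, ∀ i < k, ω' i = ω₀ i := fun ω' h' i hi => by
        by_contra hcon
        exact hmin i hi ⟨ω', h', fun h => hcon h.symm⟩
      have hd := hsep ω₀ ω k (fun i hi => (hagree ω hω i hi).symm) hne
      have hprod : 0 ≤ ∏ i ∈ Finset.range k, r (ω₀ i) := Finset.prod_nonneg fun i _ => (hr0 _).le
      calc C * P (π ⁻¹' V) ≤ C * ENNReal.ofReal (∏ i ∈ Finset.range k, r (ω₀ i) ^ (s : ℝ)) := by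
            gcongr
            exact (measure_mono fun ω' h' => hagree ω' h').trans (hcyl ω₀ k)
        _ = ENNReal.ofReal ((δ * ∏ i ∈ Finset.range k, r (ω₀ i)) ^ (s : ℝ)) := by
            rw [hC, ← ENNReal.ofReal_mul hδs.le, Real.mul_rpow hδ.le hprod,
              Real.finsetProd_rpow _ _ fun i _ => (hr0 _).le]
        _ ≤ ENNReal.ofReal (|π ω₀ - π ω| ^ (s : ℝ)) := by gcongr
        _ = edist (π ω₀) (π ω) ^ (s : ℝ) := by
            rw [edist_dist, Real.dist_eq, ENNReal.ofReal_rpow_of_nonneg (abs_nonneg _) hs'.le]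
        _ ≤ Metric.ediam V ^ (s : ℝ) := by
            gcongr
            exact Metric.edist_le_ediam_of_mem hω₀ hω
    · push Not at hA
      have hle : ∀ n : ℕ, P (π ⁻¹' V) ≤ ENNReal.ofReal q ^ n := fun n => by
        refine (measure_mono fun ω hω => ?_ : _ ≤ P {ω | ∀ k < n, ω k = ω₀ k}).trans
          ((hcyl ω₀ n).trans ?_)
        · exact fun k _ => (hA k ω hω).symm
        · rw [← ENNReal.ofReal_pow hq0]
          refine ENNReal.ofReal_le_ofReal ?_
          calc _ ≤ ∏ k ∈ Finset.range n, q :=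
                Finset.prod_le_prod (fun i _ => (hrs _).le) fun i _ => hq _
            _ = q ^ n := by simp
      have h0 : P (π ⁻¹' V) ≤ 0 := ge_of_tendsto'
        (ENNReal.tendsto_pow_atTop_nhds_zero_of_lt_one (by simpa using hq1)) hle
      rw [nonpos_iff_eq_zero.1 h0, mul_zero]
      exact zero_le
  have hH : C • μ ≤ μH[(s : ℝ)] :=
    Measure.le_hausdorffMeasure _ _ 1 one_pos fun U _ => by
      simpa using hmass U
  refine le_dimH_of_hausdorffMeasure_ne_zero (ne_of_gt ?_)
  have h1 : 1 ≤ μ (Set.range π) := by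
    -- Only this inequality is needed, so the range need not be measurable.
    refine le_trans ?_ (Measure.le_map_apply hπ.aemeasurable _)
    rw [Set.preimage_range, measure_univ]
  calc (0 : ENNReal) < C * μ (Set.range π) :=
        ENNReal.mul_pos hC0 (zero_lt_one.trans_le h1).ne'
    _ = (C • μ) (Set.range π) := by simp
    _ ≤ _ := hH _

/-! ### The branches `x ↦ 1 / (b + 1 / (1 + x))` and their compositions -/

/-- The denominator of the branch with digit `b`. -/
noncomputable def den (b : ℕ) (x : ℝ) : ℝ := b * x + b + 1

/-- The branch with digit `b`: it equals `1 / (b + 1 / (1 + x))`. -/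
noncomputable def branch (b : ℕ) (x : ℝ) : ℝ := (1 + x) / den b x

/-- The composition of the branches with digits `b 0, …, b (n - 1)`. -/
noncomputable def branchIter (b : ℕ → ℕ) : ℕ → ℝ → ℝ
  | 0, x => x
  | n + 1, x => branchIter b n (branch (b n) x)

/-- The denominator of `branchIter b n`. -/
noncomputable def denIter (b : ℕ → ℕ) : ℕ → ℝ → ℝ
  | 0, _ => 1
  | n + 1, x => denIter b n (branch (b n) x) * den (b n) x

theorem one_le_den (b : ℕ) {x : ℝ} (hx : 0 ≤ x) : 1 ≤ den b x := by
  have : (0 : ℝ) ≤ b * x := by positivity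
  have : (0 : ℝ) ≤ b := by positivity
  unfold den; linarith

theorem two_le_den {b : ℕ} (hb : 1 ≤ b) {x : ℝ} (hx : 0 ≤ x) : 2 ≤ den b x := by
  have : (0 : ℝ) ≤ b * x := by positivity
  have : (1 : ℝ) ≤ b := by exact_mod_cast hb
  unfold den; linarith

theorem branch_nonneg (b : ℕ) {x : ℝ} (hx : 0 ≤ x) : 0 ≤ branch b x :=
  div_nonneg (by linarith) (zero_le_one.trans (one_le_den b hx))

/-- The matrix with rows (1, 1) and (b, b + 1) has determinant 1. This exact formula replaces
derivative and distortion estimates. -/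
theorem branch_sub_branch (b : ℕ) {x y : ℝ} (hx : 0 ≤ x) (hy : 0 ≤ y) :
    branch b x - branch b y = (x - y) / (den b x * den b y) := by
  have h1 := one_le_den b hx
  have h2 := one_le_den b hy
  have h1' : den b x ≠ 0 := by linarith
  have h2' : den b y ≠ 0 := by linarith
  unfold branch
  field_simp
  unfold den
  ring

theorem branch_mono (b : ℕ) {x y : ℝ} (hx : 0 ≤ x) (hxy : x ≤ y) : branch b x ≤ branch b y := by
  have h := branch_sub_branch b (hx.trans hxy) hx
  have : 0 ≤ branch b y - branch b x := by
    rw [h]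
    have := one_le_den b hx
    have := one_le_den b (hx.trans hxy)
    exact div_nonneg (by linarith) (by positivity)
  linarith

/-- The condition on `κ` is exactly `branch 1 κ ≤ κ`, that is `κ ≥ (√5 - 1) / 2`; larger digits give
smaller values. Both `κ = 1` and `κ = 5/8` are used. -/
theorem branch_mem_Icc {b : ℕ} (hb : 1 ≤ b) {x κ : ℝ} (hκ : 0 ≤ κ) (hκ2 : 1 ≤ κ ^ 2 + κ)
    (hx : x ∈ Set.Icc 0 κ) : branch b x ∈ Set.Icc 0 κ := by
  refine ⟨branch_nonneg b hx.1, (branch_mono b hx.1 hx.2).trans ?_⟩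
  have hb' : (1 : ℝ) ≤ b := by exact_mod_cast hb
  have := one_le_den b hκ
  rw [branch, div_le_iff₀ (by linarith), den]
  nlinarith [mul_nonneg (sub_nonneg.2 hb') (by positivity : 0 ≤ κ ^ 2 + κ)]

theorem branchIter_nonneg (b : ℕ → ℕ) (n : ℕ) {x : ℝ} (hx : 0 ≤ x) : 0 ≤ branchIter b n x := by
  induction n generalizing x with
  | zero => exact hx
  | succ n ih => exact ih (branch_nonneg _ hx)

theorem branchIter_mem_Icc {b : ℕ → ℕ} (hb : ∀ i, 1 ≤ b i) {κ : ℝ} (hκ : 0 ≤ κ)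
    (hκ2 : 1 ≤ κ ^ 2 + κ) (n : ℕ) {x : ℝ} (hx : x ∈ Set.Icc 0 κ) :
    branchIter b n x ∈ Set.Icc 0 κ := by
  induction n generalizing x with
  | zero => exact hx
  | succ n ih => exact ih (branch_mem_Icc (hb n) hκ hκ2 hx)

theorem denIter_pos (b : ℕ → ℕ) (n : ℕ) {x : ℝ} (hx : 0 ≤ x) : 0 < denIter b n x := by
  induction n generalizing x with
  | zero => exact one_pos
  | succ n ih => exact mul_pos (ih (branch_nonneg _ hx)) (by linarith [one_le_den (b n) hx])

theorem two_pow_le_denIter {b : ℕ → ℕ} (hb : ∀ i, 1 ≤ b i) (n : ℕ) {x : ℝ} (hx : 0 ≤ x) :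
    2 ^ n ≤ denIter b n x := by
  induction n generalizing x with
  | zero => simp [denIter]
  | succ n ih =>
    rw [pow_succ, denIter]
    exact mul_le_mul (ih (branch_nonneg _ hx)) (two_le_den (hb n) hx) zero_le_two
      (denIter_pos _ _ (branch_nonneg _ hx)).le

theorem denIter_mono (b : ℕ → ℕ) (n : ℕ) {x y : ℝ} (hx : 0 ≤ x) (hxy : x ≤ y) :
    denIter b n x ≤ denIter b n y := by
  induction n generalizing x y with
  | zero => exact le_rfl
  | succ n ih =>
    have hy := hx.trans hxy
    refine mul_le_mul (ih (branch_nonneg _ hx) (branch_mono _ hx hxy)) ?_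
      (by linarith [one_le_den (b n) hx]) (denIter_pos _ _ (branch_nonneg _ hy)).le
    unfold den
    gcongr

theorem denIter_le_pow {b : ℕ → ℕ} {A : ℕ} (hb1 : ∀ i, 1 ≤ b i) (hb : ∀ i, b i ≤ A) (n : ℕ) {x : ℝ}
    (hx : x ∈ Set.Icc 0 1) : denIter b n x ≤ (2 * A + 1 : ℝ) ^ n := by
  induction n generalizing x with
  | zero => simp [denIter]
  | succ n ih =>
    rw [pow_succ, denIter]
    refine mul_le_mul (ih (branch_mem_Icc (hb1 n) zero_le_one (by norm_num) hx)) ?_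
      (by linarith [one_le_den (b n) hx.1]) (by positivity)
    have h : (b n : ℝ) ≤ A := by exact_mod_cast hb n
    have := mul_le_mul h hx.2 hx.1 (by positivity)
    unfold den
    linarith

theorem branchIter_sub_branchIter (b : ℕ → ℕ) (n : ℕ) {x y : ℝ} (hx : 0 ≤ x) (hy : 0 ≤ y) :
    branchIter b n x - branchIter b n y = (x - y) / (denIter b n x * denIter b n y) := by
  induction n generalizing x y with
  | zero => simp [branchIter, denIter]
  | succ n ih =>
    rw [branchIter, branchIter, ih (branch_nonneg _ hx) (branch_nonneg _ hy),
      branch_sub_branch _ hx hy, denIter, denIter, div_div]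
    congr 1; ring

theorem branchIter_add (b : ℕ → ℕ) (m n : ℕ) (x : ℝ) :
    branchIter b (m + n) x = branchIter b m (branchIter (fun i => b (m + i)) n x) := by
  induction n generalizing x with
  | zero => rfl
  | succ n ih => exact ih _

theorem denIter_add (b : ℕ → ℕ) (m n : ℕ) (x : ℝ) :
    denIter b (m + n) x = denIter b m (branchIter (fun i => b (m + i)) n x) *
      denIter (fun i => b (m + i)) n x := by
  induction n generalizing x with
  | zero => simp [branchIter, denIter]
  | succ n ih =>
    rw [← add_assoc, denIter, ih, denIter, branchIter, mul_assoc]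

theorem branchIter_congr {b b' : ℕ → ℕ} {n : ℕ} (h : ∀ i < n, b i = b' i) (x : ℝ) :
    branchIter b n x = branchIter b' n x := by
  induction n generalizing x with
  | zero => rfl
  | succ n ih =>
    rw [branchIter, branchIter, h n n.lt_succ_self, ih fun i hi => h i (hi.trans n.lt_succ_self)]

theorem denIter_congr {b b' : ℕ → ℕ} {n : ℕ} (h : ∀ i < n, b i = b' i) (x : ℝ) :
    denIter b n x = denIter b' n x := by
  induction n generalizing x with
  | zero => rfl
  | succ n ih =>
    rw [denIter, denIter, h n n.lt_succ_self, ih fun i hi => h i (hi.trans n.lt_succ_self)]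

/-! ### Convergence of the continued fractions -/

theorem abs_branchIter_sub_le {b : ℕ → ℕ} (hb : ∀ i, 1 ≤ b i) (n : ℕ) {x y : ℝ}
    (hx : x ∈ Set.Icc 0 1) (hy : y ∈ Set.Icc 0 1) :
    |branchIter b n x - branchIter b n y| ≤ (1 / 2) ^ n := by
  rw [branchIter_sub_branchIter b n hx.1 hy.1, abs_div]
  have h1 := two_pow_le_denIter hb n hx.1
  have h2 := two_pow_le_denIter hb n hy.1
  have h3 : (1 : ℝ) ≤ 2 ^ n := one_le_pow₀ one_le_two
  have h4 : (2 : ℝ) ^ n ≤ denIter b n x * denIter b n y := by nlinarith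
  rw [abs_of_pos (mul_pos (by linarith) (by linarith) : 0 < denIter b n x * denIter b n y), one_div,
    inv_pow, ← one_div]
  refine div_le_div₀ zero_le_one ?_ (by positivity) h4
  rw [abs_le]
  constructor <;> linarith [hx.1, hx.2, hy.1, hy.2]

/-- The limit of the compositions of branches. -/
noncomputable def branchLimit (b : ℕ → ℕ) : ℝ :=
  Filter.limUnder Filter.atTop fun n => branchIter b n 0

theorem tendsto_branchIter {b : ℕ → ℕ} (hb : ∀ i, 1 ≤ b i) :
    Filter.Tendsto (fun n => branchIter b n 0) Filter.atTop (nhds (branchLimit b)) := by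
  refine le_nhds_lim (cauchySeq_tendsto_of_complete
    (cauchySeq_of_le_geometric (1 / 2) 1 (by norm_num) fun n => ?_))
  rw [Real.dist_eq, one_mul]
  exact abs_branchIter_sub_le hb n (by norm_num)
    (branch_mem_Icc (hb n) zero_le_one (by norm_num) (by norm_num))

theorem branchLimit_mem_Icc {b : ℕ → ℕ} (hb : ∀ i, 1 ≤ b i) {κ : ℝ} (hκ : 0 ≤ κ)
    (hκ2 : 1 ≤ κ ^ 2 + κ) : branchLimit b ∈ Set.Icc 0 κ :=
  isClosed_Icc.mem_of_tendsto (tendsto_branchIter hb) (Filter.Eventually.of_forall fun n =>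
    branchIter_mem_Icc hb hκ hκ2 n ⟨le_rfl, hκ⟩)

theorem branchLimit_eq_branchIter {b : ℕ → ℕ} (hb : ∀ i, 1 ≤ b i) (m : ℕ) :
    branchLimit b = branchIter b m (branchLimit fun i => b (m + i)) := by
  have hb' : ∀ i, 1 ≤ b (m + i) := fun i => hb _
  have hL := branchLimit_mem_Icc hb' zero_le_one (by norm_num)
  have h1 := (tendsto_branchIter hb).comp (Filter.tendsto_add_atTop_nat m)
  refine tendsto_nhds_unique h1 ?_
  rw [tendsto_iff_dist_tendsto_zero]
  have h2 := tendsto_iff_dist_tendsto_zero.1 (tendsto_branchIter hb')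
  refine squeeze_zero (fun _ => dist_nonneg) (fun n => ?_) h2
  have hn := branchIter_nonneg (fun i => b (m + i)) n le_rfl
  simp only [Function.comp, Real.dist_eq]
  -- Denominators are at least 1, so `branchIter b m` does not increase distances and the limit
  -- passes through it.
  rw [add_comm n m, branchIter_add, branchIter_sub_branchIter b m hn hL.1, abs_div]
  refine div_le_self (abs_nonneg _) ?_
  have a1 := two_pow_le_denIter hb m hn
  have a2 := two_pow_le_denIter hb m hL.1
  have a3 : (1 : ℝ) ≤ 2 ^ m := one_le_pow₀ one_le_two
  exact (one_le_mul_of_one_le_of_one_le (a3.trans a1) (a3.trans a2)).trans (le_abs_self _)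

open GenContFract in
/-- The `n`-th convergent of `[b 0, 1, b 1, 1, …]`. -/
noncomputable def withOnesConv (b : ℕ → ℕ) (n : ℕ) : ℝ :=
  convs'Aux (regularCF (withOnes b)).s n

/-- Two levels of the fraction, a digit and a 1, make one branch. -/
theorem withOnesConv_add_two {b : ℕ → ℕ} (n : ℕ) (h : 0 ≤ withOnesConv (fun i => b (1 + i)) n) :
    withOnesConv b (n + 2) = branch (b 0) (withOnesConv (fun i => b (1 + i)) n) := by
  have h1 : withOnesConv b (n + 2) =
      1 / ((b 0 : ℝ) + 1 / (1 + withOnesConv (fun i => b (1 + i)) n)) := by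
    have h2 : (fun i => (⟨1, (withOnes b (i + 1 + 1) : ℝ)⟩ : GenContFract.Pair ℝ)) =
        fun i => ⟨1, (withOnes (fun j => b (1 + j)) i : ℝ)⟩ := by
      funext i
      have : (i + 1 + 1) / 2 = 1 + i / 2 := by omega
      simp [withOnes, this, Nat.even_add_one]
    have h3 : withOnesConv b (n + 2) = 1 / ((withOnes b 0 : ℝ) + 1 / ((withOnes b 1 : ℝ) +
        GenContFract.convs'Aux (Stream'.Seq.ofStream fun i =>
          (⟨1, (withOnes b (i + 1 + 1) : ℝ)⟩ : GenContFract.Pair ℝ)) n)) := rfl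
    rw [h3, h2]
    simp [withOnes, withOnesConv, regularCF]
  rw [h1, branch, den]
  generalize withOnesConv (fun i => b (1 + i)) n = y at h
  have : (0 : ℝ) ≤ b 0 := by positivity
  have : (0 : ℝ) < b 0 * y + b 0 + 1 := by positivity
  have : (0 : ℝ) < b 0 * (1 + y) + 1 := by positivity
  field_simp
  ring

theorem withOnesConv_mem_Icc {b : ℕ → ℕ} (hb : ∀ i, 1 ≤ b i) (n : ℕ) :
    withOnesConv b n ∈ Set.Icc 0 1 := by
  induction n using Nat.twoStepInduction generalizing b with
  | zero => exact ⟨le_rfl, zero_le_one⟩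
  | one =>
    have h : withOnesConv b 1 = 1 / ((b 0 : ℝ) + 0) := rfl
    have hb' : (1 : ℝ) ≤ b 0 := by exact_mod_cast hb 0
    rw [h, add_zero]
    exact ⟨by positivity, div_le_one_of_le₀ hb' (by positivity)⟩
  | more n ih _ =>
    have := ih (b := fun i => b (1 + i)) fun i => hb _
    rw [withOnesConv_add_two n this.1]
    exact branch_mem_Icc (hb 0) zero_le_one (by norm_num) this

theorem withOnesConv_two_mul_add {b : ℕ → ℕ} (hb : ∀ i, 1 ≤ b i) (n k : ℕ) :
    withOnesConv b (2 * n + k) = branchIter b n (withOnesConv (fun i => b (n + i)) k) := by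
  induction n generalizing b with
  | zero => simp [branchIter]
  | succ n ih =>
    have hb' : ∀ i, 1 ≤ b (1 + i) := fun i => hb _
    rw [show 2 * (n + 1) + k = 2 * n + k + 2 by ring,
      withOnesConv_add_two _ (withOnesConv_mem_Icc hb' _).1, ih hb', add_comm n 1, branchIter_add]
    simp only [branchIter, add_assoc]

theorem hasCFValue_branchLimit {b : ℕ → ℕ} (hb : ∀ i, 1 ≤ b i) :
    HasCFValue (withOnes b) (branchLimit b) := by
  have hconv : (regularCF (withOnes b)).convs = withOnesConv b := by
    funext n
    rw [GenContFract.convs_eq_convs', GenContFract.convs', withOnesConv]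
    · exact zero_add _
    · intro gp m _ hm
      have : gp = ⟨1, (withOnes b m : ℝ)⟩ := (Option.some.inj hm).symm
      subst this
      refine ⟨one_pos, ?_⟩
      have : 0 < withOnes b m := by
        unfold withOnes
        split_ifs
        exacts [hb _, one_pos]
      exact Nat.cast_pos.2 this
  have hhalf : Filter.Tendsto (fun n : ℕ => n / 2) Filter.atTop Filter.atTop :=
    Filter.tendsto_atTop.2 fun c => Filter.eventually_atTop.2 ⟨2 * c, fun n hn => by omega⟩
  rw [HasCFValue, hconv]
  have h1 := (tendsto_branchIter hb).comp hhalf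
  have h2 : Filter.Tendsto (fun n : ℕ => ((1 : ℝ) / 2) ^ (n / 2)) Filter.atTop (nhds 0) :=
    (tendsto_pow_atTop_nhds_zero_of_lt_one (by norm_num) (by norm_num)).comp hhalf
  -- The `n`-th convergent is `branchIter b (n / 2)` at a point of [0, 1], whatever the parity of
  -- `n`, hence within `2 ^ (-(n / 2))` of the value at 0.
  refine tendsto_of_tendsto_of_dist h1 (squeeze_zero (fun _ => dist_nonneg) (fun n => ?_) h2)
  conv_lhs => rw [← Nat.div_add_mod n 2, withOnesConv_two_mul_add hb]
  rw [Function.comp_apply, Real.dist_eq, Nat.div_add_mod]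
  exact abs_branchIter_sub_le hb _ (by norm_num) (withOnesConv_mem_Icc (fun i => hb _) _)

/-! ### Certified integer arithmetic for powers with exponent `-31/20` -/

/-- Evaluates `f n` after reducing `n` to a literal in the kernel. -/
def forceNat {α : Type} (n : ℕ) (f : ℕ → α) : α :=
  match n with
  | 0 => f 0
  | k + 1 => f (k + 1)

theorem forceNat_eq {α : Type} (n : ℕ) (f : ℕ → α) : forceNat n f = f n := by
  cases n <;> rfl

/-- One Newton step for the solution `a` of `a ^ 20 * q = (2 ^ 60) ^ 20`. -/
def newtonStep (q a : ℕ) : ℕ := a + a * (Nat.pow 2 1200 - Nat.pow a 20 * q) / (20 * Nat.pow 2 1200)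

/-- Iterated Newton steps. -/
def newtonIter (q : ℕ) : ℕ → ℕ → ℕ
  | 0, a => a
  | n + 1, a => forceNat (newtonStep q a) fun a' => newtonIter q n a'

/-- An integer approximation from below to `2 ^ 60 * Q ^ (-31 / 20)`, found by `n` Newton steps from
the initial value `a`; it is `0` if the approximation fails. -/
def powApprox (n Q a : ℕ) : ℕ :=
  forceNat (Q ^ 31) fun q => forceNat (newtonIter q n a) fun a' =>
    if a' ^ 20 * q ≤ (2 ^ 60) ^ 20 then a' else 0

/-- Accumulated integer data for the tangent lower bounds of a sum of powers: the base and the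
approximate power of the last summand, the sum of the values and the sum of the slopes. -/
structure TangentState where
  /-- base of the last summand -/
  base : ℕ
  /-- approximation to the last power -/
  power : ℕ
  /-- sum of the lower bounds at the centre -/
  value : ℕ
  /-- sum of the upper bounds for the slopes at the centre -/
  slope : ℕ

/-- Adds the summand with base `Q` and velocity `u` to the accumulated data. -/
def TangentState.step (n u Q : ℕ) (st : TangentState) : TangentState :=
  forceNat (powApprox n Q (st.power - 31 * st.power * (Q - st.base) / (20 * Q))) fun a =>
  forceNat (st.value + a) fun A =>
  forceNat (st.slope + (31 * a * u / (20 * Q) + 1)) fun G => ⟨Q, a, A, G⟩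

/-- The data for the first `B` summands `((d + (d + e) * b) * T + 128 * (d + e)) ^ (-31 / 20)`. -/
def tangentLoop (d e T : ℕ) : ℕ → TangentState
  -- The seed lies just below `2 ^ 60 * 2048 ^ (-31/20)`. Later seeds extrapolate along the tangent
  -- from the previous summand; this is coarsest for small `B`, which gets more Newton steps.
  | 0 => ⟨2048, 8496360000000, 0, 0⟩
  | B + 1 => (tangentLoop d e T B).step (2 + 12 / (B + 1)) (d + (d + e) * (B + 1))
      ((d + (d + e) * (B + 1)) * T + 128 * (d + e))

/-- A candidate for an upper bound of `2 ^ 60 * Q ^ (-31 / 20)`. -/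
def powUpper (Q : ℕ) : ℕ := powApprox 16 Q (24879108095000 * 1024 ^ 2 / Q ^ 2) + 2

/-- Tests whether `a` is an upper bound of `2 ^ 60 * Q ^ (-31 / 20)`. -/
def isPowUpper (Q a : ℕ) : Bool := (2 ^ 60) ^ 20 ≤ a ^ 20 * Q ^ 31

/-- The integer inequality that certifies the eigenfunction inequality for all
`128 * t ∈ [T - 1, T + 1]`, `T = 129 + 2 * m`. -/
def cellCheck (m : ℕ) : Bool :=
  let x := tangentLoop 7 1 (129 + 2 * m) 110
  let y := tangentLoop 5 4 (129 + 2 * m) 110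
  let A := 46 * x.value + 9 * y.value
  let G := 46 * x.slope + 9 * y.slope
  let q1 := 7 * (130 + 2 * m) + 128 * 1
  let q2 := 5 * (130 + 2 * m) + 128 * 4
  let q3 := 7 * (128 + 2 * m) + 128 * 1
  let q4 := 5 * (128 + 2 * m) + 128 * 4
  isPowUpper q1 (powUpper q1) && isPowUpper q2 (powUpper q2) &&
  isPowUpper q3 (powUpper q3) && isPowUpper q4 (powUpper q4) &&
  (20001 * (46 * powUpper q1 + 9 * powUpper q2) + 20000 * G ≤ 20000 * A : Bool) &&
  (20001 * (46 * powUpper q3 + 9 * powUpper q4) + 20000 * (110 * 55) ≤ 20000 * (A + G) : Bool)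

theorem cellCheck_true : ∀ m < 40, cellCheck m = true := by decide +kernel

/-- Twentieth powers clear the fractional exponent, so comparisons with integers become integer
inequalities. -/
theorem scaled_rpow_pow {Q : ℝ} (hQ : 0 < Q) :
    (2 ^ 60 * Q ^ (-(31 / 20) : ℝ)) ^ 20 * Q ^ 31 = (2 ^ 60) ^ 20 := by
  rw [mul_pow, ← Real.rpow_natCast (Q ^ _), ← Real.rpow_mul hQ.le, mul_assoc,
    ← Real.rpow_natCast Q 31, ← Real.rpow_add hQ,
    show (-(31 / 20) : ℝ) * (20 : ℕ) + (31 : ℕ) = 0 by norm_num, Real.rpow_zero, mul_one]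

theorem le_scaled_rpow_iff {Q a : ℝ} (hQ : 0 < Q) (ha : 0 ≤ a) :
    a ≤ 2 ^ 60 * Q ^ (-(31 / 20) : ℝ) ↔ a ^ 20 * Q ^ 31 ≤ (2 ^ 60) ^ 20 := by
  rw [← scaled_rpow_pow hQ, mul_le_mul_iff_left₀ (by positivity),
    pow_le_pow_iff_left₀ ha (by positivity) (by norm_num)]

theorem scaled_rpow_le_iff {Q a : ℝ} (hQ : 0 < Q) (ha : 0 ≤ a) :
    2 ^ 60 * Q ^ (-(31 / 20) : ℝ) ≤ a ↔ (2 ^ 60) ^ 20 ≤ a ^ 20 * Q ^ 31 := by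
  rw [← scaled_rpow_pow hQ, mul_le_mul_iff_left₀ (by positivity),
    pow_le_pow_iff_left₀ (by positivity) ha (by norm_num)]

/-- Only the final test inside `powApprox` matters: neither the seed nor the convergence of Newton's
method needs justification. -/
theorem powApprox_le {n Q a : ℕ} (hQ : 0 < Q) :
    (powApprox n Q a : ℝ) ≤ 2 ^ 60 * (Q : ℝ) ^ (-(31 / 20) : ℝ) := by
  have hQ' : (0 : ℝ) < Q := by exact_mod_cast hQ
  simp only [powApprox, forceNat_eq]
  split_ifs with h
  · rw [le_scaled_rpow_iff hQ' (by positivity)]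
    exact_mod_cast h
  · rw [Nat.cast_zero]; positivity

theorem le_of_isPowUpper {Q a : ℕ} (hQ : 0 < Q) (h : isPowUpper Q a = true) :
    2 ^ 60 * (Q : ℝ) ^ (-(31 / 20) : ℝ) ≤ a := by
  rw [scaled_rpow_le_iff (by exact_mod_cast hQ) (by positivity)]
  have := of_decide_eq_true h
  exact_mod_cast (this : (2 ^ 60) ^ 20 ≤ a ^ 20 * Q ^ 31)

/-! ### Tangents and chords of negative powers -/

/-- Bernoulli's inequality, from `1 + t ≤ exp t` and `log (1 + z) ≤ z`. -/
theorem one_sub_mul_le_rpow_neg {z p : ℝ} (hz : -1 < z) (hp : 0 ≤ p) :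
    1 - p * z ≤ (1 + z) ^ (-p) := by
  have h1 : 0 < 1 + z := by linarith
  rw [Real.rpow_def_of_pos h1]
  have h2 := Real.add_one_le_exp (Real.log (1 + z) * -p)
  have h3 := Real.log_le_sub_one_of_pos h1
  nlinarith

theorem rpow_neg_tangent_le {x y p : ℝ} (hx : 0 < x) (hy : 0 < y) (hp : 0 ≤ p) :
    x ^ (-p) * (1 - p * ((y - x) / x)) ≤ y ^ (-p) := by
  have hz : (-1 : ℝ) < (y - x) / x := by rw [lt_div_iff₀ hx]; linarith
  have h := one_sub_mul_le_rpow_neg hz hp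
  have e : y = x * (1 + (y - x) / x) := by field_simp; ring
  conv_rhs => rw [e, Real.mul_rpow hx.le (by linarith)]
  gcongr

/-- Averaging the tangent bounds at the intermediate point cancels the linear terms. -/
theorem rpow_neg_le_chord {x y α β p : ℝ} (hx : 0 < x) (hy : 0 < y) (hα : 0 ≤ α) (hβ : 0 ≤ β)
    (h : α + β = 1) (hp : 0 ≤ p) :
    (α * x + β * y) ^ (-p) ≤ α * x ^ (-p) + β * y ^ (-p) := by
  have hz : 0 < α * x + β * y := by
    rcases hα.eq_or_lt with rfl | h'
    · have : β = 1 := by linarith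
      subst this; linarith
    · nlinarith [mul_pos h' hx, mul_nonneg hβ hy.le]
  set z := α * x + β * y with hzdef
  have h1 := mul_le_mul_of_nonneg_left (rpow_neg_tangent_le hz hx hp) hα
  have h2 := mul_le_mul_of_nonneg_left (rpow_neg_tangent_le hz hy hp) hβ
  have e : α * (z ^ (-p) * (1 - p * ((x - z) / z))) + β * (z ^ (-p) * (1 - p * ((y - z) / z)))
      = z ^ (-p) * ((α + β) - p * ((α * x + β * y - (α + β) * z) / z)) := by ring
  rw [h, ← hzdef] at e
  simp only [one_mul, sub_self, zero_div, mul_zero, sub_zero, mul_one] at e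
  linarith

/-- The tangent at `s = 0`, written as the affine interpolation of its values at `s = 1` and `s =
-1`. Each stored slope is rounded up by at most 1, which is safe at `s = 1`; at `s = -1` it is
repaid by the `- B`. -/
theorem tangentLoop_le_sum {d e T : ℕ} (hd : 0 < d) (hT : 128 ≤ T) {s : ℝ}
    (hs : s ∈ Set.Icc (-1) 1) (B : ℕ) :
    (1 + s) / 2 * ((tangentLoop d e T B).value - (tangentLoop d e T B).slope : ℝ) +
      (1 - s) / 2 * ((tangentLoop d e T B).value + (tangentLoop d e T B).slope - B : ℝ) ≤
    2 ^ 60 * ∑ b ∈ Finset.range B,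
      (((d + (d + e) * (b + 1) : ℝ) * (T + s) + 128 * (d + e)) ^ (-(31 / 20) : ℝ)) := by
  induction B with
  | zero => simp [tangentLoop]
  | succ B ih =>
    rw [Finset.sum_range_succ]
    set st := tangentLoop d e T B
    set u : ℕ := d + (d + e) * (B + 1) with hu
    set Q : ℕ := u * T + 128 * (d + e) with hQ
    have hu0 : 0 < u := by omega
    have hQ0 : 0 < Q := by positivity
    set a : ℕ := powApprox (2 + 12 / (B + 1)) Q
      (st.power - 31 * st.power * (Q - st.base) / (20 * Q)) with ha
    have hstep : tangentLoop d e T (B + 1) =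
        ⟨Q, a, st.value + a, st.slope + (31 * a * u / (20 * Q) + 1)⟩ := by
      simp only [tangentLoop, TangentState.step, forceNat_eq]
      rfl
    rw [hstep]
    set f : ℕ := 31 * a * u / (20 * Q) with hf
    have ha1 : (a : ℝ) ≤ 2 ^ 60 * (Q : ℝ) ^ (-(31 / 20) : ℝ) := powApprox_le hQ0
    have hQr : (0 : ℝ) < Q := by exact_mod_cast hQ0
    have hur : (0 : ℝ) < u := by exact_mod_cast hu0
    have huQ : 128 * (u : ℝ) ≤ Q := by
      have : 128 * u ≤ Q := by rw [hQ]; nlinarith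
      exact_mod_cast this
    have hf1 : (f : ℝ) ≤ 31 / 20 * (a * u / Q) := by
      have : f * (20 * Q) ≤ 31 * a * u := Nat.div_mul_le_self _ _
      have h : (f : ℝ) * (20 * Q) ≤ 31 * a * u := by exact_mod_cast this
      rw [← mul_div_assoc, le_div_iff₀ hQr]; linarith
    have hf2 : 31 / 20 * (a * u / Q) ≤ (f : ℝ) + 1 := by
      have : 31 * a * u < (f + 1) * (20 * Q) := by
        rw [mul_comm (f + 1)]; exact Nat.lt_mul_div_succ _ (by positivity)
      have h : (31 : ℝ) * a * u < (f + 1) * (20 * Q) := by exact_mod_cast this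
      rw [← mul_div_assoc, div_le_iff₀ hQr]; linarith
    have hcast : ((d + (d + e) * (B + 1) : ℝ) * (T + s) + 128 * (d + e)) = Q + s * u := by
      rw [hQ, hu]; push_cast; ring
    have hpos : (0 : ℝ) < Q + s * u := by nlinarith [hs.1, hs.2]
    have htan := rpow_neg_tangent_le hQr hpos (p := 31 / 20) (by norm_num)
    rw [hcast]
    -- This factor must be nonnegative for the lower approximation `a` to be usable in place of the
    -- power.
    have hfac : 0 ≤ 1 - 31 / 20 * ((Q + s * u - Q) / Q : ℝ) := by
      have : (Q + s * u - Q : ℝ) / Q ≤ 1 / 128 := by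
        rw [div_le_iff₀ hQr]; nlinarith [hs.1, hs.2]
      linarith
    have hmain : (a : ℝ) * (1 - 31 / 20 * ((Q + s * u - Q) / Q : ℝ)) ≤
        2 ^ 60 * (Q + s * u : ℝ) ^ (-(31 / 20) : ℝ) := by
      calc _ ≤ (2 ^ 60 * (Q : ℝ) ^ (-(31 / 20) : ℝ)) * (1 - 31 / 20 * ((Q + s * u - Q) / Q : ℝ)) :=
            mul_le_mul_of_nonneg_right ha1 hfac
        _ ≤ _ := by rw [mul_assoc]; exact mul_le_mul_of_nonneg_left htan (by positivity)
    have e1 : (a : ℝ) * (1 - 31 / 20 * ((Q + s * u - Q) / Q : ℝ)) =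
        (1 + s) / 2 * (a - 31 / 20 * (a * u / Q)) + (1 - s) / 2 * (a + 31 / 20 * (a * u / Q)) := by
      ring
    have h1 : (1 + s) / 2 * (a - (f + 1) : ℝ) ≤ (1 + s) / 2 * (a - 31 / 20 * (a * u / Q)) :=
      mul_le_mul_of_nonneg_left (by linarith) (by linarith [hs.1])
    have h2 : (1 - s) / 2 * (a + f : ℝ) ≤ (1 - s) / 2 * (a + 31 / 20 * (a * u / Q)) :=
      mul_le_mul_of_nonneg_left (by linarith) (by linarith [hs.2])
    push_cast
    linarith

/-! ### The eigenfunction inequality -/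

/-- A function that is nearly an eigenfunction of the transfer operator. -/
noncomputable def testFun (x : ℝ) : ℝ :=
  46 * (7 * (x + 1) + 1) ^ (-(31 / 20) : ℝ) + 9 * (5 * (x + 1) + 4) ^ (-(31 / 20) : ℝ)

/-- A chord bounds the left side and tangents the right side. Both bounds are affine in `s`, so the
inequalities `hplus` at `s = 1` and `hminus` at `s = -1` suffice. -/
theorem scaled_testFun_le_sum {m : ℕ} (hm : cellCheck m = true) {s : ℝ}
    (hs : s ∈ Set.Icc (-1) 1) :
    20001 / 20000 * (46 * (7 * (129 + 2 * m + s : ℝ) + 128 * 1) ^ (-(31 / 20) : ℝ) +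
      9 * (5 * (129 + 2 * m + s : ℝ) + 128 * 4) ^ (-(31 / 20) : ℝ)) ≤
    46 * ∑ b ∈ Finset.range 110,
      (((7 + (7 + 1) * (b + 1) : ℝ) * (129 + 2 * m + s) + 128 * (7 + 1)) ^ (-(31 / 20) : ℝ)) +
    9 * ∑ b ∈ Finset.range 110,
      (((5 + (5 + 4) * (b + 1) : ℝ) * (129 + 2 * m + s) + 128 * (5 + 4)) ^ (-(31 / 20) : ℝ)) := by
  simp only [cellCheck, Bool.and_eq_true, decide_eq_true_eq] at hm
  obtain ⟨⟨⟨⟨⟨u1, u2⟩, u3⟩, u4⟩, hplus⟩, hminus⟩ := hm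
  have hx := tangentLoop_le_sum (d := 7) (e := 1) (T := 129 + 2 * m) (by norm_num) (by omega) hs 110
  have hy := tangentLoop_le_sum (d := 5) (e := 4) (T := 129 + 2 * m) (by norm_num) (by omega) hs 110
  have v1 := le_of_isPowUpper (by omega) u1
  have v2 := le_of_isPowUpper (by omega) u2
  have v3 := le_of_isPowUpper (by omega) u3
  have v4 := le_of_isPowUpper (by omega) u4
  generalize tangentLoop 7 1 (129 + 2 * m) 110 = x at *
  generalize tangentLoop 5 4 (129 + 2 * m) 110 = y at *
  generalize powUpper (7 * (130 + 2 * m) + 128 * 1) = p1 at *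
  generalize powUpper (5 * (130 + 2 * m) + 128 * 4) = p2 at *
  generalize powUpper (7 * (128 + 2 * m) + 128 * 1) = p3 at *
  generalize powUpper (5 * (128 + 2 * m) + 128 * 4) = p4 at *
  have hp : (20001 * (46 * p1 + 9 * p2) + 20000 * (46 * x.slope + 9 * y.slope) : ℝ) ≤
      20000 * (46 * x.value + 9 * y.value) := by exact_mod_cast hplus
  -- The term `110 * 55` collects the slope roundings: 110 summands in each loop, with weights 46 +
  -- 9.
  have hq : (20001 * (46 * p3 + 9 * p4) + 20000 * (110 * 55) : ℝ) ≤
      20000 * (46 * x.value + 9 * y.value + (46 * x.slope + 9 * y.slope)) := by exact_mod_cast hminus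
  push_cast at v1 v2 v3 v4 hx hy
  have hm0 : (0 : ℝ) ≤ m := by positivity
  have hα : 0 ≤ (1 + s) / 2 := by linarith [hs.1]
  have hβ : 0 ≤ (1 - s) / 2 := by linarith [hs.2]
  have c1 := rpow_neg_le_chord (x := 7 * (130 + 2 * m) + 128) (y := 7 * (128 + 2 * m) + 128)
    (p := 31 / 20) (by positivity) (by positivity) hα hβ (by ring) (by norm_num)
  have c2 := rpow_neg_le_chord (x := 5 * (130 + 2 * m) + 512) (y := 5 * (128 + 2 * m) + 512)
    (p := 31 / 20) (by positivity) (by positivity) hα hβ (by ring) (by norm_num)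
  rw [show (1 + s) / 2 * (7 * (130 + 2 * m) + 128) + (1 - s) / 2 * (7 * (128 + 2 * m) + 128)
    = 7 * (129 + 2 * m + s) + 128 * 1 by ring] at c1
  rw [show (1 + s) / 2 * (5 * (130 + 2 * m) + 512) + (1 - s) / 2 * (5 * (128 + 2 * m) + 512)
    = 5 * (129 + 2 * m + s) + 128 * 4 by ring] at c2
  have w1 := mul_le_mul_of_nonneg_left v1 hα
  have w2 := mul_le_mul_of_nonneg_left v2 hα
  have w3 := mul_le_mul_of_nonneg_left v3 hβ
  have w4 := mul_le_mul_of_nonneg_left v4 hβ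
  have hp' := mul_le_mul_of_nonneg_left hp hα
  have hq' := mul_le_mul_of_nonneg_left hq hβ
  generalize ((7 : ℝ) * (129 + 2 * m + s) + 128 * 1) ^ (-(31 / 20) : ℝ) = X1 at *
  generalize ((5 : ℝ) * (129 + 2 * m + s) + 128 * 4) ^ (-(31 / 20) : ℝ) = X2 at *
  generalize ((7 : ℝ) * (130 + 2 * m) + 128) ^ (-(31 / 20) : ℝ) = Y1 at *
  generalize ((5 : ℝ) * (130 + 2 * m) + 512) ^ (-(31 / 20) : ℝ) = Y2 at *
  generalize ((7 : ℝ) * (128 + 2 * m) + 128) ^ (-(31 / 20) : ℝ) = Y3 at *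
  generalize ((5 : ℝ) * (128 + 2 * m) + 512) ^ (-(31 / 20) : ℝ) = Y4 at *
  linarith

theorem testFun_le_transfer {x : ℝ} (hx : x ∈ Set.Icc (0 : ℝ) (5 / 8)) :
    20001 / 20000 * testFun x ≤ ∑ b ∈ Finset.range 110,
      ((b + 1 : ℝ) * x + (b + 1) + 1) ^ (-(31 / 20) : ℝ) *
        testFun ((1 + x) / ((b + 1 : ℝ) * x + (b + 1) + 1)) := by
  obtain ⟨hx0, hx1⟩ := hx
  obtain ⟨m, hm, s, hs, hxm⟩ : ∃ m : ℕ, m < 40 ∧ ∃ s ∈ Set.Icc (-1 : ℝ) 1,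
      128 * (x + 1) = 129 + 2 * m + s := by
    rcases hx1.eq_or_lt with rfl | hlt
    -- Cells have width 1/64 in `x`. The endpoint 5/8 would fall into cell 40 by the floor formula,
    -- so it is taken as the right end of cell 39.
    · exact ⟨39, by norm_num, 1, by norm_num, by norm_num⟩
    · refine ⟨⌊64 * x⌋₊, (Nat.floor_lt (by positivity)).2 (by push_cast; linarith),
        128 * (x + 1) - 129 - 2 * ⌊64 * x⌋₊, ⟨?_, ?_⟩, by ring⟩
      · linarith [Nat.floor_le (show 0 ≤ 64 * x by positivity)]
      · linarith [Nat.lt_floor_add_one (64 * x)]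
  have key := scaled_testFun_le_sum (cellCheck_true m hm) hs
  rw [← hxm] at key
  have hscale : ∀ {u v : ℝ}, 0 ≤ u * (x + 1) + v →
      (u * (128 * (x + 1)) + 128 * v) ^ (-(31 / 20) : ℝ) =
        128 ^ (-(31 / 20) : ℝ) * (u * (x + 1) + v) ^ (-(31 / 20) : ℝ) := by
    intro u v h
    rw [← Real.mul_rpow (by norm_num) h]; congr 1; ring
  -- The denominator of the branch cancels against the weight; this is why `testFun` is built from
  -- such powers.
  have hterm : ∀ (b : ℕ) {d e : ℝ}, 0 < d → 0 < e →
      ((b + 1 : ℝ) * x + (b + 1) + 1) ^ (-(31 / 20) : ℝ) *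
        (d * ((1 + x) / ((b + 1 : ℝ) * x + (b + 1) + 1) + 1) + e) ^ (-(31 / 20) : ℝ) =
      ((d + (d + e) * (b + 1)) * (x + 1) + (d + e)) ^ (-(31 / 20) : ℝ) := by
    intro b d e hd he
    have : (0 : ℝ) < (b + 1 : ℝ) * x + (b + 1) + 1 := by positivity
    rw [← Real.mul_rpow this.le (by positivity)]
    congr 1; field_simp; ring
  rw [hscale (by positivity), hscale (by positivity),
    Finset.sum_congr rfl fun (b : ℕ) _ => hscale (u := 7 + (7 + 1) * (b + 1)) (v := 7 + 1)
      (by positivity),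
    Finset.sum_congr rfl fun (b : ℕ) _ => hscale (u := 5 + (5 + 4) * (b + 1)) (v := 5 + 4)
      (by positivity),
    ← Finset.mul_sum, ← Finset.mul_sum] at key
  have hc : (0 : ℝ) < 128 ^ (-(31 / 20) : ℝ) := by positivity
  have hsum : (∑ b ∈ Finset.range 110, ((b + 1 : ℝ) * x + (b + 1) + 1) ^ (-(31 / 20) : ℝ) *
        testFun ((1 + x) / ((b + 1 : ℝ) * x + (b + 1) + 1))) =
      46 * ∑ b ∈ Finset.range 110,
        ((7 + (7 + 1) * (b + 1) : ℝ) * (x + 1) + (7 + 1)) ^ (-(31 / 20) : ℝ) +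
      9 * ∑ b ∈ Finset.range 110,
        ((5 + (5 + 4) * (b + 1) : ℝ) * (x + 1) + (5 + 4)) ^ (-(31 / 20) : ℝ) := by
    rw [Finset.mul_sum, Finset.mul_sum, ← Finset.sum_add_distrib]
    refine Finset.sum_congr rfl fun b _ => ?_
    rw [← hterm b (by norm_num : (0 : ℝ) < 7) one_pos,
      ← hterm b (by norm_num : (0 : ℝ) < 5) (by norm_num : (0 : ℝ) < 4), testFun]
    ring
  rw [hsum, testFun]
  refine le_of_mul_le_mul_left ?_ hc
  linarith

/-! ### Separation of points with different digits -/

/-- Images of [0, 1] under different branches are disjoint and ordered by digit. The gap after `b`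
is at least the distance from `branch b 0 = 1 / (b + 1)` to `branch (b + 1) 1 = 2 / (2 b + 3)`. -/
theorem le_abs_branch_sub_branch {A b b' : ℕ} (hA : b ≤ A) (hA' : b' ≤ A) (hne : b ≠ b') {x y : ℝ}
    (hx : x ∈ Set.Icc 0 1) (hy : y ∈ Set.Icc 0 1) :
    1 / ((A + 1) * (2 * A + 3) : ℝ) ≤ |branch b x - branch b' y| := by
  wlog hlt : b < b' generalizing b b' x y
  · rw [abs_sub_comm]
    exact this hA' hA hne.symm hy hx (by omega)
  have h1 := branch_mono b le_rfl hx.1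
  have h2 := branch_mono b' hy.1 hy.2
  have e1 : branch b 0 = 1 / (b + 1) := by simp [branch, den]
  have e2 : branch b' 1 ≤ 2 / (2 * b + 3) := by
    have h : (b + 1 : ℝ) ≤ b' := by exact_mod_cast hlt
    rw [branch, den]
    refine div_le_div₀ zero_le_two (by norm_num) (by positivity) (by linarith)
  have hb : (b : ℝ) ≤ A := by exact_mod_cast hA
  have e3 : (1 : ℝ) / (b + 1) - 2 / (2 * b + 3) = 1 / ((b + 1) * (2 * b + 3)) := by
    field_simp
    ring
  have e4 : 1 / ((A + 1) * (2 * A + 3) : ℝ) ≤ 1 / ((b + 1) * (2 * b + 3)) := by gcongr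
  exact (by linarith : _ ≤ branch b x - branch b' y).trans (le_abs_self _)

/-- The tails after the common prefix differ by the first-digit gap; the exact difference formula
shrinks it by two denominators, each largest at `κ`. -/
theorem le_abs_branchLimit_sub {A : ℕ} {b b' : ℕ → ℕ} (hb : ∀ i, 1 ≤ b i ∧ b i ≤ A)
    (hb' : ∀ i, 1 ≤ b' i ∧ b' i ≤ A) {N : ℕ} (hagree : ∀ i < N, b i = b' i) (hne : b N ≠ b' N)
    {κ : ℝ} (hκ : 0 ≤ κ) (hκ1 : κ ≤ 1) (hκ2 : 1 ≤ κ ^ 2 + κ) :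
    1 / ((A + 1) * (2 * A + 3) : ℝ) / denIter b N κ ^ 2 ≤ |branchLimit b - branchLimit b'| := by
  have key : ∀ c : ℕ → ℕ, (∀ i, 1 ≤ c i) → ∃ z ∈ Set.Icc 0 κ, branchLimit c = branch (c 0) z := by
    intro c hc
    exact ⟨_, branchLimit_mem_Icc (fun i => hc _) hκ hκ2, branchLimit_eq_branchIter hc 1⟩
  have hs : ∀ i, 1 ≤ b (N + i) := fun i => (hb _).1
  have hs' : ∀ i, 1 ≤ b' (N + i) := fun i => (hb' _).1
  obtain ⟨z, hz, hyz⟩ := key _ hs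
  obtain ⟨z', hz', hyz'⟩ := key _ hs'
  have hy := branchLimit_mem_Icc hs hκ hκ2
  have hy' := branchLimit_mem_Icc hs' hκ hκ2
  have hgap := le_abs_branch_sub_branch (hb (N + 0)).2 (hb' (N + 0)).2 hne
    ⟨hz.1, hz.2.trans hκ1⟩ ⟨hz'.1, hz'.2.trans hκ1⟩
  rw [← hyz, ← hyz'] at hgap
  rw [branchLimit_eq_branchIter (fun i => (hb i).1) N,
    branchLimit_eq_branchIter (fun i => (hb' i).1) N,
    ← branchIter_congr hagree, branchIter_sub_branchIter b N hy.1 hy'.1, abs_div]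
  have p1 := denIter_pos b N hy.1
  have p2 := denIter_pos b N hy'.1
  rw [abs_of_pos (mul_pos p1 p2), sq]
  exact div_le_div₀ (abs_nonneg _) hgap (mul_pos p1 p2) (mul_le_mul (denIter_mono b N hy.1 hy.2)
    (denIter_mono b N hy'.1 hy'.2) p2.le (denIter_pos b N hκ).le)

/-! ### Words of digits -/

/-- The digit sequence that starts with the word `w` (with letters shifted by one) and goes on with
ones. -/
def wordSeq {A n : ℕ} (w : Fin n → Fin A) (k : ℕ) : ℕ :=
  if h : k < n then w ⟨k, h⟩ + 1 else 1

/-- The concatenation of a sequence of words of positive length `n`. -/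
def concatWords {A n : ℕ} (hn : 0 < n) (ω : ℕ → Fin n → Fin A) (k : ℕ) : ℕ :=
  ω (k / n) ⟨k % n, Nat.mod_lt _ hn⟩ + 1

theorem one_le_wordSeq {A n : ℕ} (w : Fin n → Fin A) (k : ℕ) : 1 ≤ wordSeq w k := by
  unfold wordSeq; split_ifs <;> omega

theorem concatWords_mem {A n : ℕ} (hn : 0 < n) (ω : ℕ → Fin n → Fin A) (k : ℕ) :
    1 ≤ concatWords hn ω k ∧ concatWords hn ω k ≤ A :=
  ⟨Nat.le_add_left _ _, (ω _ _).2⟩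

theorem concatWords_mul_add {A n : ℕ} (hn : 0 < n) (ω : ℕ → Fin n → Fin A) (k : ℕ) {j : ℕ}
    (hj : j < n) : concatWords hn ω (k * n + j) = ω k ⟨j, hj⟩ + 1 := by
  have h1 : (k * n + j) / n = k := by
    rw [mul_comm, Nat.mul_add_div hn, Nat.div_eq_of_lt hj, add_zero]
  have h2 : (k * n + j) % n = j := by
    rw [mul_comm, Nat.mul_add_mod, Nat.mod_eq_of_lt hj]
  simp only [concatWords, h1, h2]

/-- Denominators form a cocycle and increase in `x`, so replacing every inner point by `κ` gives a
product over blocks. -/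
theorem denIter_concatWords_le {A n : ℕ} (hn : 0 < n) (ω : ℕ → Fin n → Fin A) {κ : ℝ} (hκ : 0 ≤ κ)
    (hκ2 : 1 ≤ κ ^ 2 + κ) (k : ℕ) :
    denIter (concatWords hn ω) (k * n) κ ≤ ∏ i ∈ Finset.range k, denIter (wordSeq (ω i)) n κ := by
  induction k with
  | zero => simp [denIter]
  | succ k ih =>
    have hmem := branchIter_mem_Icc (b := fun i => concatWords hn ω (k * n + i))
      (fun i => (concatWords_mem hn ω _).1) hκ hκ2 n ⟨hκ, le_rfl⟩
    have hcongr : denIter (fun i => concatWords hn ω (k * n + i)) n κ =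
        denIter (wordSeq (ω k)) n κ := by
      refine denIter_congr (fun i hi => ?_) κ
      rw [concatWords_mul_add hn ω k hi, wordSeq, dif_pos hi]
    rw [Finset.prod_range_succ, Nat.succ_mul, denIter_add, hcongr]
    exact mul_le_mul_of_nonneg_right ((denIter_mono _ _ hmem.1 hmem.2).trans ih)
      (denIter_pos _ _ hκ).le

theorem le_abs_branchLimit_concatWords_sub {A n : ℕ} (hn : 0 < n) (ω ω' : ℕ → Fin n → Fin A) (k : ℕ)
    (hagree : ∀ i < k, ω i = ω' i) (hne : ω k ≠ ω' k) {κ : ℝ} (hκ : 0 ≤ κ) (hκ1 : κ ≤ 1)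
    (hκ2 : 1 ≤ κ ^ 2 + κ) :
    1 / ((A + 1) * (2 * A + 3) : ℝ) / (((2 * A + 1 : ℝ) ^ n) ^ 2) *
      ∏ i ∈ Finset.range k, (denIter (wordSeq (ω i)) n κ ^ 2)⁻¹ ≤
    |branchLimit (concatWords hn ω) - branchLimit (concatWords hn ω')| := by
  set b := concatWords hn ω with hb
  set b' := concatWords hn ω' with hb'
  -- `N` is the first differing digit, at offset `j` in block `k`. The incomplete block costs a
  -- factor of at most `(2 A + 1) ^ n` in the denominator, absorbed into the separation constant.
  obtain ⟨N, j, hj, rfl, hN, hNne⟩ : ∃ N j, j < n ∧ N = k * n + j ∧ (∀ i < N, b i = b' i) ∧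
      b N ≠ b' N := by
    have hex : ∃ j, ∃ h : j < n, b (k * n + j) ≠ b' (k * n + j) := by
      obtain ⟨j, hj⟩ := Function.ne_iff.1 hne
      refine ⟨j, j.2, fun h => hj ?_⟩
      rw [hb, hb', concatWords_mul_add hn _ _ j.2, concatWords_mul_add hn _ _ j.2] at h
      exact Fin.ext (Nat.succ_injective h)
    classical
    have hmin := fun m hm => Nat.find_min hex (m := m) hm
    obtain ⟨hj, hjne⟩ := Nat.find_spec hex
    refine ⟨_, Nat.find hex, hj, rfl, fun i hi => ?_, hjne⟩
    rcases lt_or_ge i (k * n) with h | h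
    · have : i / n < k := (Nat.div_lt_iff_lt_mul hn).2 h
      simp only [hb, hb', concatWords, hagree _ this]
    · obtain ⟨m, rfl⟩ := Nat.exists_eq_add_of_le h
      by_contra hcon
      exact hmin m (by omega) ⟨by omega, hcon⟩
  refine le_trans ?_ (le_abs_branchLimit_sub (concatWords_mem hn ω) (concatWords_mem hn ω') hN hNne
    hκ hκ1 hκ2)
  have hpos := denIter_pos b (k * n + j) hκ
  have hle : denIter b (k * n + j) κ ≤
      (2 * A + 1 : ℝ) ^ n * ∏ i ∈ Finset.range k, denIter (wordSeq (ω i)) n κ := by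
    have hb1 : ∀ i, 1 ≤ b (k * n + i) := fun i => (concatWords_mem hn ω _).1
    have hmem := branchIter_mem_Icc hb1 hκ hκ2 j ⟨hκ, le_rfl⟩
    rw [denIter_add, mul_comm ((2 * A + 1 : ℝ) ^ n)]
    refine mul_le_mul ((denIter_mono _ _ hmem.1 hmem.2).trans
      (denIter_concatWords_le hn ω hκ hκ2 k)) ?_ (denIter_pos _ _ hκ).le
      (Finset.prod_nonneg fun i _ => (denIter_pos _ _ hκ).le)
    refine (denIter_le_pow hb1 (fun i => (concatWords_mem hn ω _).2) j ⟨hκ, hκ1⟩).trans ?_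
    exact pow_le_pow_right₀ (by linarith [(Nat.cast_nonneg A : (0 : ℝ) ≤ A)]) hj.le
  rw [Finset.prod_inv_distrib, Finset.prod_pow, div_mul_eq_mul_div, ← div_eq_mul_inv, div_div,
    ← mul_pow, mul_comm (∏ i ∈ Finset.range k, _)]
  gcongr

theorem measurable_branchLimit_concatWords {A n : ℕ} (hn : 0 < n) :
    Measurable fun ω : ℕ → Fin n → Fin A => branchLimit (concatWords hn ω) := by
  -- Joint measurability in the code and the point is needed, since the recursion changes the point.
  have hiter : ∀ m, Measurable fun p : (ℕ → Fin n → Fin A) × ℝ =>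
      branchIter (concatWords hn p.1) m p.2 := by
    intro m
    induction m with
    | zero => exact measurable_snd
    | succ m ih =>
      have hdig : Measurable fun p : (ℕ → Fin n → Fin A) × ℝ => (concatWords hn p.1 m : ℝ) := by
        have h1 : Measurable fun p : (ℕ → Fin n → Fin A) × ℝ =>
            p.1 (m / n) ⟨m % n, Nat.mod_lt _ hn⟩ := by
          fun_prop
        exact (measurable_of_finite fun a : Fin A => ((a + 1 : ℕ) : ℝ)).comp h1
      have hbr : Measurable fun p : (ℕ → Fin n → Fin A) × ℝ => branch (concatWords hn p.1 m) p.2 := by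
        unfold branch den
        fun_prop
      exact ih.comp (measurable_fst.prodMk hbr)
  refine measurable_of_tendsto_metrizable (fun m => (hiter m).comp (measurable_id.prodMk
    (measurable_const (a := (0 : ℝ))))) (tendsto_pi_nhds.2 fun ω => ?_)
  exact tendsto_branchIter fun i => (concatWords_mem hn ω i).1

theorem range_branchLimit_concatWords_subset {A n : ℕ} (hn : 0 < n) :
    (Set.range fun ω : ℕ → Fin n → Fin A => branchLimit (concatWords hn ω)) ⊆ fractalC A := by
  rintro _ ⟨ω, rfl⟩
  exact ⟨_, concatWords_mem hn ω, hasCFValue_branchLimit fun i => (concatWords_mem hn ω i).1⟩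

/-! ### Growth of the iterated transfer operator -/

theorem testFun_pos {x : ℝ} (hx : 0 ≤ x) : 0 < testFun x := by
  unfold testFun; positivity

theorem testFun_le {x : ℝ} (hx : 0 ≤ x) : testFun x ≤ 55 := by
  have h1 : (7 * (x + 1) + 1) ^ (-(31 / 20) : ℝ) ≤ 1 :=
    Real.rpow_le_one_of_one_le_of_nonpos (by linarith) (by norm_num)
  have h2 : (5 * (x + 1) + 4) ^ (-(31 / 20) : ℝ) ≤ 1 :=
    Real.rpow_le_one_of_one_le_of_nonpos (by linarith) (by norm_num)
  unfold testFun; linarith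

theorem pow_mul_testFun_le_sum (n : ℕ) {x : ℝ} (hx : x ∈ Set.Icc (0 : ℝ) (5 / 8)) :
    (20001 / 20000) ^ n * testFun x ≤ ∑ w : Fin n → Fin 110,
      denIter (wordSeq w) n x ^ (-(31 / 20) : ℝ) * testFun (branchIter (wordSeq w) n x) := by
  induction n generalizing x with
  | zero => simp [denIter, branchIter]
  | succ n ih =>
    have hmem : ∀ a : Fin 110, branch (a + 1) x ∈ Set.Icc (0 : ℝ) (5 / 8) := fun a =>
      branch_mem_Icc (Nat.le_add_left _ _) (by norm_num) (by norm_num) hx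
    have hden : ∀ a : Fin 110, 0 < den (a + 1) x := fun a => by
      linarith [one_le_den (a + 1) hx.1]
    calc (20001 / 20000) ^ (n + 1) * testFun x
        = (20001 / 20000) ^ n * (20001 / 20000 * testFun x) := by ring
      _ ≤ (20001 / 20000) ^ n * ∑ a : Fin 110,
          den (a + 1) x ^ (-(31 / 20) : ℝ) * testFun (branch (a + 1) x) := by
        refine mul_le_mul_of_nonneg_left ((testFun_le_transfer hx).trans_eq ?_) (by positivity)
        rw [Finset.sum_range]
        simp only [branch, den, Nat.cast_add, Nat.cast_one]
      _ = ∑ a : Fin 110, den (a + 1) x ^ (-(31 / 20) : ℝ) *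
          ((20001 / 20000) ^ n * testFun (branch (a + 1) x)) := by
        rw [Finset.mul_sum]
        exact Finset.sum_congr rfl fun a _ => by ring
      _ ≤ ∑ a : Fin 110, den (a + 1) x ^ (-(31 / 20) : ℝ) * ∑ w : Fin n → Fin 110,
          denIter (wordSeq w) n (branch (a + 1) x) ^ (-(31 / 20) : ℝ) *
            testFun (branchIter (wordSeq w) n (branch (a + 1) x)) :=
        Finset.sum_le_sum fun a _ => mul_le_mul_of_nonneg_left (ih (hmem a))
          (Real.rpow_nonneg (hden a).le _)
      _ = _ := by
        -- The new letter goes last in the word because the last digit is the innermost branch, the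
        -- first to act on `x`.
        rw [← (Fin.snocEquiv fun _ : Fin (n + 1) => Fin 110).sum_comp, Fintype.sum_prod_type]
        refine Finset.sum_congr rfl fun a _ => ?_
        rw [Finset.mul_sum]
        refine Finset.sum_congr rfl fun w _ => ?_
        have hlast : wordSeq (Fin.snoc w a : Fin (n + 1) → Fin 110) n = a + 1 := by
          rw [wordSeq, dif_pos n.lt_succ_self]
          exact congrArg (fun c : Fin 110 => (c : ℕ) + 1) (Fin.snoc_last (α := fun _ => Fin 110) a w)
        have hinit : ∀ i < n, wordSeq (Fin.snoc w a : Fin (n + 1) → Fin 110) i = wordSeq w i := by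
          intro i hi
          rw [wordSeq, wordSeq, dif_pos (hi.trans n.lt_succ_self), dif_pos hi]
          exact congrArg (fun c : Fin 110 => (c : ℕ) + 1)
            (Fin.snoc_castSucc (α := fun _ => Fin 110) a w ⟨i, hi⟩)
        change _ = denIter (wordSeq (Fin.snoc w a : Fin (n + 1) → Fin 110)) (n + 1) x ^ _ *
          testFun (branchIter (wordSeq (Fin.snoc w a : Fin (n + 1) → Fin 110)) (n + 1) x)
        rw [denIter, branchIter, hlast, denIter_congr hinit, branchIter_congr hinit,
          Real.mul_rpow (denIter_pos _ _ (hmem a).1).le (hden a).le]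
        ring

/-- Since `testFun ≤ 55` and `testFun (5/8) > 0`, the sum is at least `(20001/20000) ^ n * testFun
(5/8) / 55`, which is unbounded in `n`. -/
theorem exists_one_lt_sum_denIter : ∃ n, 0 < n ∧
    1 < ∑ w : Fin n → Fin 110, denIter (wordSeq w) n (5 / 8) ^ (-(31 / 20) : ℝ) := by
  have hκ : (5 / 8 : ℝ) ∈ Set.Icc (0 : ℝ) (5 / 8) := by norm_num
  have hpos := testFun_pos hκ.1
  obtain ⟨n, hn⟩ := pow_unbounded_of_one_lt (55 / testFun (5 / 8))
    (by norm_num : (1 : ℝ) < 20001 / 20000)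
  have hn' : 55 / testFun (5 / 8) < (20001 / 20000) ^ (n + 1) :=
    hn.trans_le (pow_le_pow_right₀ (by norm_num) n.le_succ)
  refine ⟨n + 1, n.succ_pos, ?_⟩
  rw [div_lt_iff₀ hpos] at hn'
  have h1 := pow_mul_testFun_le_sum (n + 1) hκ
  have h2 : ∑ w : Fin (n + 1) → Fin 110, denIter (wordSeq w) (n + 1) (5 / 8) ^ (-(31 / 20) : ℝ) *
      testFun (branchIter (wordSeq w) (n + 1) (5 / 8)) ≤
      ∑ w : Fin (n + 1) → Fin 110, denIter (wordSeq w) (n + 1) (5 / 8) ^ (-(31 / 20) : ℝ) * 55 :=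
    Finset.sum_le_sum fun w _ => mul_le_mul_of_nonneg_left
      (testFun_le (branchIter_nonneg _ _ hκ.1)) (Real.rpow_nonneg (denIter_pos _ _ hκ.1).le _)
  rw [← Finset.sum_mul] at h2
  linarith

/-! ### The dimension bounds -/

theorem lt_dimH_fractalC : ENNReal.ofReal 0.775 < dimH (fractalC 110) := by
  obtain ⟨n, hn, hsum⟩ := exists_one_lt_sum_denIter
  have hκ : (0 : ℝ) ≤ 5 / 8 := by norm_num
  set r : (Fin n → Fin 110) → ℝ := fun w => (denIter (wordSeq w) n (5 / 8) ^ 2)⁻¹ with hr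
  have hden : ∀ w : Fin n → Fin 110, 1 < denIter (wordSeq w) n (5 / 8) := fun w =>
    (one_lt_pow₀ one_lt_two hn.ne').trans_le (two_pow_le_denIter (one_le_wordSeq w) n hκ)
  have hr0 : ∀ w, 0 < r w := fun w => inv_pos.2 (pow_pos (zero_lt_one.trans (hden w)) 2)
  have hr1 : ∀ w, r w < 1 := fun w => inv_lt_one_of_one_lt₀ (one_lt_pow₀ (hden w) two_ne_zero)
  have hsum' : 1 < ∑ w, r w ^ (0.775 : ℝ) := by
    refine hsum.trans_eq (Finset.sum_congr rfl fun w _ => ?_)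
    have h0 := (zero_lt_one.trans (hden w)).le
    rw [hr, Real.inv_rpow (by positivity), ← Real.rpow_neg (by positivity), ← Real.rpow_natCast,
      ← Real.rpow_mul h0]
    norm_num
  have hcont : Continuous fun s : ℝ => ∑ w, r w ^ s :=
    continuous_finsetSum _ fun w _ => Real.continuous_const_rpow (hr0 w).ne'
  -- The sum is still above 1 for some exponent beyond 0.775, which yields the strict inequality.
  obtain ⟨s, hs1, hs⟩ : ∃ s : ℝ, 1 < ∑ w, r w ^ s ∧ 0.775 < s :=
    (((hcont.tendsto 0.775).eventually_const_lt hsum').filter_mono nhdsWithin_le_nhds |>.and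
      (self_mem_nhdsWithin (s := Set.Ioi (0.775 : ℝ)))).exists
  have hs0 : 0 < s := lt_trans (by norm_num) hs
  have hdim := le_dimH_range_of_separated (measurable_branchLimit_concatWords (A := 110) hn) hr0 hr1
    (by positivity) (fun ω ω' k h1 h2 => le_abs_branchLimit_concatWords_sub hn ω ω' k h1 h2 hκ
      (by norm_num) (by norm_num)) (s := s.toNNReal)
    (Real.toNNReal_pos.2 hs0) (by rw [Real.coe_toNNReal _ hs0.le]; exact hs1.le)
  refine lt_of_lt_of_le ?_ (hdim.trans (dimH_mono (range_branchLimit_concatWords_subset hn)))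
  exact (ENNReal.ofReal_lt_ofReal_iff hs0).2 hs

theorem theorem1p17 :
    ENNReal.ofReal 0.775 < dimH fractalCInfty ∧
      ENNReal.ofReal 0.775 < dimH (fractalC 110) := by
  refine ⟨lt_dimH_fractalC.trans_le (dimH_mono ?_), lt_dimH_fractalC⟩
  exact Set.subset_biUnion_of_mem (u := fractalC) (Set.mem_Ici.2 (by norm_num : 1 ≤ 110))
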